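/- **Theorem (regret of Online $\mathsf{SDS}_{\mathsf{MA}}$).** *Setting.* Let $V$ be a nonempty finite set of atoms, $n=|V|$, let $\mathbf A\in\mathbb R^{d\times V}$ be the matrix whose columns are the atoms, and let $1\le s\le k$ and $T\ge 0$ be integers. Let $u:\mathbb R^d\times\mathbb R^d\to\mathbb R$ be a utility function and $\mathbf y_1,\dots,\mathbf y_T\in\mathbb R^d$ a fixed sequence of data points, with $u(\mathbf y_t,\mathbf 0)\ge 0$ for all $t$. Put $u_t(\mathbf w)=u(\mathbf y_t,\mathbf A\mathbf w)$ for $\mathbf w\in\mathbb R^V$, and let $\|\mathbf w\|_0$ be the number of nonzero entries of $\mathbf w$. For $r\ge 1$ let $\Omega_r$ be the set of pairs $(\mathbf x,\mathbf z)\in\mathbb R^V\times\mathbb R^V$ with $\|\mathbf x\|_0,\|\mathbf z\|_0,\|\mathbf x-\mathbf z\|_0\le r$. Assume that every $u_t$ is continuously differentiable and that there are real constants $m_1,m_s,M_1,M_s>0$ such that, for $r\in\{1,s\}$, all $t$ and all $(\mathbf x,\mathbf z)\in\Omega_r$, $$-\tfrac{m_r}{2}\|\mathbf z-\mathbf x\|_2^2\;\ge\;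 u_t(\mathbf z)-u_t(\mathbf x)-\langle\nabla u_t(\mathbf x),\mathbf z-\mathbf x\rangle\;\ge\;-\tfrac{M_r}{2}\|\mathbf z-\mathbf x\|_2^2 .$$ For $Z,X\subseteq V$ let $$f_t(Z)=\max_{\mathrm{supp}(\mathbf w)\subseteq Z,\ \|\mathbf w\|_0\le s}u_t(\mathbf w),\qquad g_t(X)=\max_{Z\subseteq X,\ |Z|\le s}f_t(Z),$$ $$f_t(a|\emptyset)=f_t(\{a\})-f_t(\emptyset),\qquad \tilde g_t(X)=\max_{Z\subseteq X,\ |Z|\le s}\ \sum_{a\in Z}f_t(a|\emptyset),\qquad \Delta_{\max}=\max_{a\in V}\max_{t\le T}f_t(a|\emptyset)$$ ($\Delta_{\max}=0$ if $T=0$). *Algorithm.* Online $\mathsf{SDS}_{\mathsf{MA}}$ is the online greedy algorithm run on $\tilde g_1,\dots,\tilde g_T$ with $k$ hedge subroutines $\mathcal A^1,\dots,\mathcal A^k$. In round $t$, given the previous rounds, $\mathcal A^1,\dots,\mathcal A^k$ independently draw $a_t^1,\dots,a_t^k\in V$, where $$\Pr[a_t^i=a]\ \propto\ \exp\Big(\eta\sum_{\tau<t}\delta_\tau^i(a)\Big),\qquad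 \eta=\frac{1}{\Delta_{\max}}\sqrt{\frac{2\ln n}{T}}$$ ($\eta=0$ if $\Delta_{\max}=0$ or $T=0$). The algorithm plays $X_t=\{a_t^1,\dots,a_t^k\}$, then $\mathbf y_t$ is revealed, and $\mathcal A^i$ is fed, for every $a\in V$, the gain $\delta_t^i(a)=\tilde g_t(\{a_t^1,\dots,a_t^{i-1}\}\cup\{a\})-\tilde g_t(\{a_t^1,\dots,a_t^{i-1}\})$. *Claim.* The maxima defining $f_t(Z)$ are attained for all $t$ and all $Z\subseteq V$, and with $\alpha=\left(1-\frac1{\mathrm e}\right)\frac{m_1m_s}{M_1M_s}$ the expected $\alpha$-regret satisfies $$\alpha\max_{X^*\subseteq V,\ |X^*|\le k}\ \sum_{t=1}^T g_t(X^*)-\mathbb E\Big[\sum_{t=1}^T g_t(X_t)\Big]\ \le\ \frac{k\,\Delta_{\max}\,m_1}{M_s}\sqrt{2T\ln n},$$ where the expectation is over the random draws of the algorithm. -/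

import Mathlib

open Finset

noncomputable section

/-! ### Sparse vectors, restricted strong concavity and restricted smoothness -/

/-- The support of a vector indexed by `V`. -/
def vecSupp {V : Type*} [Fintype V] (w : EuclideanSpace ℝ V) : Finset V :=
  univ.filter fun i => w i ≠ 0

/-- The number of nonzero entries of a vector. -/
def l0norm {V : Type*} [Fintype V] (w : EuclideanSpace ℝ V) : ℕ := (vecSupp w).card

/-- Pairs of `s`-sparse vectors whose difference is `p`-sparse. -/
def OmegaSet (V : Type*) [Fintype V] (s p : ℕ) :
    Set (EuclideanSpace ℝ V × EuclideanSpace ℝ V) :=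
  {q | l0norm q.1 ≤ s ∧ l0norm q.2 ≤ s ∧ l0norm (q.1 - q.2) ≤ p}

/-- `v` is restricted strongly concave on `Ω` with parameter `m`. -/
def RestrictedStronglyConcave {V : Type*} [Fintype V] (v : EuclideanSpace ℝ V → ℝ)
    (Ω : Set (EuclideanSpace ℝ V × EuclideanSpace ℝ V)) (m : ℝ) : Prop :=
  ∀ x z, (x, z) ∈ Ω →
    v z - v x - inner ℝ (gradient v x) (z - x) ≤ -(m / 2) * ‖z - x‖ ^ 2

/-- `v` is restricted smooth on `Ω` with parameter `M`. -/
def RestrictedSmooth {V : Type*} [Fintype V] (v : EuclideanSpace ℝ V → ℝ)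
    (Ω : Set (EuclideanSpace ℝ V × EuclideanSpace ℝ V)) (M : ℝ) : Prop :=
  ∀ x z, (x, z) ∈ Ω →
    -(M / 2) * ‖z - x‖ ^ 2 ≤ v z - v x - inner ℝ (gradient v x) (z - x)

/-! ### The objective and its modular surrogate -/

/-- The function `w ↦ u(y, A w)`. -/
def dataUtility {V : Type*} [Fintype V] {d : ℕ} (A : Matrix (Fin d) V ℝ)
    (u : EuclideanSpace ℝ (Fin d) → EuclideanSpace ℝ (Fin d) → ℝ)
    (y : EuclideanSpace ℝ (Fin d)) (w : EuclideanSpace ℝ V) : ℝ :=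
  u y (WithLp.toLp 2 (A.mulVec w.ofLp))

/-- The `s`-sparse coefficient vectors supported on `Z`. -/
def sparseOn {V : Type*} [Fintype V] (s : ℕ) (Z : Finset V) : Set (EuclideanSpace ℝ V) :=
  {w | vecSupp w ⊆ Z ∧ l0norm w ≤ s}

/-- `f(Z)`: the maximum of `v` over the `s`-sparse vectors supported on `Z`. -/
def supportValue {V : Type*} [Fintype V] (s : ℕ) (v : EuclideanSpace ℝ V → ℝ)
    (Z : Finset V) : ℝ :=
  sSup (v '' sparseOn s Z)

/-- The maximum of `f` over the subsets of `X` of size at most `s`. -/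
def maxSparse {V : Type*} [DecidableEq V] (s : ℕ) (f : Finset V → ℝ) (X : Finset V) : ℝ :=
  (X.powerset.filter fun Z => Z.card ≤ s).sup' ⟨∅, by simp⟩ f

/-- The marginal gain `f(a | ∅) = f({a}) - f(∅)`. -/
def singletonGain {V : Type*} (f : Finset V → ℝ) (a : V) : ℝ := f {a} - f ∅

/-- The modular approximation `Z ↦ ∑ a ∈ Z, f(a | ∅)`. -/
def modularApprox {V : Type*} (f : Finset V → ℝ) (Z : Finset V) : ℝ :=
  ∑ a ∈ Z, singletonGain f a

/-- The objective `g` of a round: the best `s`-sparse approximation from a dictionary. -/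
def objective {V : Type*} [Fintype V] [DecidableEq V] (s : ℕ) (v : EuclideanSpace ℝ V → ℝ) :
    Finset V → ℝ :=
  maxSparse s (supportValue s v)

/-- The surrogate objective of a round. -/
def surrogate {V : Type*} [Fintype V] [DecidableEq V] (s : ℕ) (v : EuclideanSpace ℝ V → ℝ) :
    Finset V → ℝ :=
  maxSparse s (modularApprox (supportValue s v))

/-! ### The online greedy algorithm with hedge subroutines

A trajectory `ω : Fin T → Fin k → V` records the element `ω t i` picked in round `t` by the
`i`-th subroutine.  `F t` is the set function revealed at the end of round `t`. -/

/-- The set of elements picked by the subroutines preceding `i`. -/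
def prefixSet {V : Type*} [DecidableEq V] {k : ℕ} (r : Fin k → V) (i : Fin k) : Finset V :=
  (Finset.Iio i).image r

/-- The dictionary played in a round in which the picks are `r`. -/
def playedSet {V : Type*} [DecidableEq V] {k : ℕ} (r : Fin k → V) : Finset V :=
  univ.image r

/-- The gain of `a` fed to subroutine `i` after a round with set function `G` and picks `r`:
the marginal gain of adding `a` to the picks of the preceding subroutines. -/
def feedback {V : Type*} [DecidableEq V] {k : ℕ} (G : Finset V → ℝ) (r : Fin k → V)
    (i : Fin k) (a : V) : ℝ :=
  G (insert a (prefixSet r i)) - G (prefixSet r i)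

/-- The weight of `a` in subroutine `i` at the beginning of round `t`: the exponential of `η` times
the total gain of `a` over the previous rounds. -/
def hedgeWeight {V : Type*} [DecidableEq V] {T k : ℕ} (F : Fin T → Finset V → ℝ) (η : ℝ)
    (ω : Fin T → Fin k → V) (t : Fin T) (i : Fin k) (a : V) : ℝ :=
  Real.exp (η * ∑ τ ∈ Finset.Iio t, feedback (F τ) (ω τ) i a)

/-- The probability with which subroutine `i` picks `a` in round `t`, given the earlier rounds. -/
def hedgeProb {V : Type*} [Fintype V] [DecidableEq V] {T k : ℕ} (F : Fin T → Finset V → ℝ)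
    (η : ℝ) (ω : Fin T → Fin k → V) (t : Fin T) (i : Fin k) (a : V) : ℝ :=
  hedgeWeight F η ω t i a / ∑ b, hedgeWeight F η ω t i b

/-- The probability of a trajectory: given the earlier rounds, the `k` subroutines draw their
elements of the current round independently. -/
def trajProb {V : Type*} [Fintype V] [DecidableEq V] {T k : ℕ} (F : Fin T → Finset V → ℝ)
    (η : ℝ) (ω : Fin T → Fin k → V) : ℝ :=
  ∏ t, ∏ i, hedgeProb F η ω t i (ω t i)

/-- Expectation of a function of the trajectory. -/
def trajExp {V : Type*} [Fintype V] [DecidableEq V] {T k : ℕ} (F : Fin T → Finset V → ℝ)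
    (η : ℝ) (φ : (Fin T → Fin k → V) → ℝ) : ℝ :=
  ∑ ω, trajProb F η ω * φ ω

theorem trajProb_nonneg {V : Type*} [Fintype V] [DecidableEq V] {T k : ℕ}
    (F : Fin T → Finset V → ℝ) (η : ℝ) (ω : Fin T → Fin k → V) : 0 ≤ trajProb F η ω := by
  unfold trajProb hedgeProb hedgeWeight
  positivity

theorem hedgeProb_sum {V : Type*} [Fintype V] [DecidableEq V] [Nonempty V] {T k : ℕ}
    (F : Fin T → Finset V → ℝ) (η : ℝ) (ω : Fin T → Fin k → V) (t : Fin T) (i : Fin k) :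
    ∑ a, hedgeProb F η ω t i a = 1 := by
  unfold hedgeProb
  rw [← Finset.sum_div]
  apply div_self
  have : 0 < ∑ b, hedgeWeight F η ω t i b :=
    Finset.sum_pos (fun b _ => Real.exp_pos _) Finset.univ_nonempty
  exact this.ne'

theorem hedgeProb_snoc_castSucc {V : Type*} [Fintype V] [DecidableEq V] {T k : ℕ}
    (F : Fin (T + 1) → Finset V → ℝ) (η : ℝ) (ω : Fin T → Fin k → V) (r : Fin k → V)
    (t : Fin T) (i : Fin k) (a : V) :
    hedgeProb F η (Fin.snoc ω r : Fin (T + 1) → Fin k → V) t.castSucc i a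
      = hedgeProb (fun τ => F τ.castSucc) η ω t i a := by
  have h : ∀ b, hedgeWeight F η (Fin.snoc ω r : Fin (T + 1) → Fin k → V) t.castSucc i b
      = hedgeWeight (fun τ => F τ.castSucc) η ω t i b := by
    intro b
    unfold hedgeWeight
    rw [← Fin.map_castSuccEmb_Iio, Finset.sum_map]
    simp
  unfold hedgeProb
  simp only [h]

theorem hedgeProb_snoc_last {V : Type*} [Fintype V] [DecidableEq V] {T k : ℕ}
    (F : Fin (T + 1) → Finset V → ℝ) (η : ℝ) (ω : Fin T → Fin k → V) (r r' : Fin k → V)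
    (i : Fin k) (a : V) :
    hedgeProb F η (Fin.snoc ω r : Fin (T + 1) → Fin k → V) (Fin.last T) i a
      = hedgeProb F η (Fin.snoc ω r' : Fin (T + 1) → Fin k → V) (Fin.last T) i a := by
  have h : ∀ b, hedgeWeight F η (Fin.snoc ω r : Fin (T + 1) → Fin k → V) (Fin.last T) i b
      = hedgeWeight F η (Fin.snoc ω r' : Fin (T + 1) → Fin k → V) (Fin.last T) i b := by
    intro b
    unfold hedgeWeight
    congr 2
    refine Finset.sum_congr rfl fun τ hτ => ?_
    obtain ⟨σ, rfl⟩ := Fin.exists_castSucc_eq.2 (Finset.mem_Iio.1 hτ).ne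
    simp
  unfold hedgeProb
  simp only [h]

/-- The trajectory probabilities form a probability distribution. -/
theorem trajProb_sum {V : Type*} [Fintype V] [DecidableEq V] [Nonempty V] {k : ℕ} (η : ℝ) :
    ∀ {T : ℕ} (F : Fin T → Finset V → ℝ), ∑ ω : Fin T → Fin k → V, trajProb F η ω = 1
  | 0, F => by simp [trajProb]
  | T + 1, F => by
    rw [← (Fin.snocEquiv fun _ : Fin (T + 1) => Fin k → V).sum_comp, Fintype.sum_prod_type,
      Finset.sum_comm]
    rw [← trajProb_sum η (k := k) fun τ => F τ.castSucc]
    refine Finset.sum_congr rfl fun ω _ => ?_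
    obtain ⟨v⟩ := ‹Nonempty V›
    have h : ∀ r : Fin k → V,
        trajProb F η (Fin.snocEquiv (fun _ : Fin (T + 1) => Fin k → V) (r, ω))
        = trajProb (fun τ => F τ.castSucc) η ω * ∏ i, hedgeProb F η
          (Fin.snoc ω (fun _ => v) : Fin (T + 1) → Fin k → V) (Fin.last T) i (r i) := by
      intro r
      unfold trajProb
      rw [Fin.prod_univ_castSucc]
      simp only [Fin.snocEquiv, Equiv.coe_fn_mk, Fin.snoc_castSucc, Fin.snoc_last]
      congr 1
      · simp only [hedgeProb_snoc_castSucc]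
      · exact Finset.prod_congr rfl fun i _ => hedgeProb_snoc_last F η ω r _ i _
    have : Nonempty V := ⟨v⟩
    simp only [h, ← Finset.mul_sum]
    have h2 := Finset.prod_univ_sum (fun _ : Fin k => (univ : Finset V)) fun i a =>
      hedgeProb F η (Fin.snoc ω (fun _ => v) : Fin (T + 1) → Fin k → V) (Fin.last T) i a
    simp only [hedgeProb_sum, Finset.prod_const_one, Fintype.piFinset_univ] at h2
    rw [← h2, mul_one]

/-! ### The learning rate and the expected `α`-regret -/

/-- The hedge learning rate for `N` experts, `T` rounds and gains in `[0, Δ]`. -/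
def hedgeRate (N T : ℕ) (Δ : ℝ) : ℝ := Real.sqrt (2 * Real.log N / T) / Δ

/-- `max_a max_t f_t(a | ∅)`. -/
def maxGain {V : Type*} {T : ℕ} (f : Fin T → Finset V → ℝ) : ℝ :=
  ⨆ a : V, ⨆ t : Fin T, singletonGain (f t) a

/-- The expected `α`-regret, against the rewards `g t`, of the online greedy algorithm with hedge
subroutines of learning rate `η` run on the set functions `F t`. -/
def onlineGreedyRegret {V : Type*} [Fintype V] [DecidableEq V] {T : ℕ} (k : ℕ) (α : ℝ)
    (g F : Fin T → Finset V → ℝ) (η : ℝ) : ℝ :=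
  α * ((univ : Finset (Finset V)).filter fun X => X.card ≤ k).sup' ⟨∅, by simp⟩
      (fun X => ∑ t, g t X)
    - trajExp F η fun ω : Fin T → Fin k → V => ∑ t, g t (playedSet (ω t))

end

/-! The surrogate of a round is the sum of the `s` largest nonnegative weights in a set. It is
monotone, submodular and zero at `∅`, and one atom raises it by at most `Δmax`, so online greedy has
small `(1 - 1/e)`-regret on it. What remains is to compare surrogate and objective.

Both are controlled by the squared gradient entries at the origin. For `|Z| ≤ r`, the quantity `f(Z)
- f(∅)` lies between `∑ a ∈ Z, (∇v(0) a)² / (2 M_r)` and the same sum over `2 m_r`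
(`le_supportValue_sub`, `supportValue_sub_le`; the lower bound needs `r ≤ s`). Using `r = 1` for the
weights and `r = s` for the objective, `objective_sub_bounds` places `g - v(0)` between `m₁/Mₛ` and
`M₁/mₛ` times the surrogate. Since `α M₁/mₛ = (1 - 1/e) m₁/Mₛ`, the surrogate regret carries over
with factor `m₁/Mₛ`. The offset `∑ v(0) ≥ 0` does no harm because `α ≤ 1`.

For online greedy (`online_greedy_regret`), submodularity bounds the remaining gap to a comparator
by the gains of its at most `k` elements. Each of these gains is, up to the hedge regret, at most
the gain of the current slot, so a slot shrinks the gap by the factor `1 - 1/k`. The gains fed to a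
slot are random, but the hedge bound holds along every trajectory for mean gains.
`trajExp_sum_feedback` passes to realised gains, because a slot's gain function does not depend on
its own current draw. -/

/-! ### Sparse vectors and attainment of the maxima -/

theorem mem_vecSupp {V : Type*} [Fintype V] {w : EuclideanSpace ℝ V} {i : V} :
    i ∈ vecSupp w ↔ w i ≠ 0 := by
  simp [vecSupp]

@[simp]
theorem vecSupp_zero {V : Type*} [Fintype V] : vecSupp (0 : EuclideanSpace ℝ V) = ∅ := by
  simp [vecSupp]

@[simp]
theorem l0norm_zero {V : Type*} [Fintype V] : l0norm (0 : EuclideanSpace ℝ V) = 0 := by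
  simp [l0norm]

@[simp]
theorem vecSupp_neg {V : Type*} [Fintype V] (w : EuclideanSpace ℝ V) :
    vecSupp (-w) = vecSupp w := by
  simp [vecSupp]

theorem vecSupp_subset_iff {V : Type*} [Fintype V] {w : EuclideanSpace ℝ V} {Z : Finset V} :
    vecSupp w ⊆ Z ↔ ∀ i ∉ Z, w i = 0 := by
  simp only [Finset.subset_iff, mem_vecSupp]
  exact forall_congr' fun i => not_imp_comm

theorem zero_mem_sparseOn {V : Type*} [Fintype V] (s : ℕ) (Z : Finset V) :
    (0 : EuclideanSpace ℝ V) ∈ sparseOn s Z := by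
  simp [sparseOn]

/-- Concavity and smoothness are only ever applied at the base point `0`, where the three sparsity
conditions collapse to one. -/
theorem zero_pair_mem_OmegaSet {V : Type*} [Fintype V] {r : ℕ} {w : EuclideanSpace ℝ V}
    (hw : l0norm w ≤ r) : ((0 : EuclideanSpace ℝ V), w) ∈ OmegaSet V r r := by
  refine ⟨by simp, hw, ?_⟩
  simpa [l0norm] using hw

/-- The set is a finite union of coordinate subspaces, one for each admissible support. -/
theorem isClosed_sparseOn {V : Type*} [Fintype V] [DecidableEq V] (s : ℕ) (Z : Finset V) :
    IsClosed (sparseOn s Z) := by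
  have h : sparseOn s Z = ⋃ Y ∈ Z.powerset.filter (fun Y => Y.card ≤ s),
      {w : EuclideanSpace ℝ V | ∀ i ∉ Y, w i = 0} := by
    ext w
    simp only [sparseOn, Set.mem_ofPred_eq, Set.mem_iUnion, Finset.mem_filter,
      Finset.mem_powerset, exists_prop, ← vecSupp_subset_iff]
    exact ⟨fun hw => ⟨vecSupp w, hw, Finset.Subset.refl _⟩,
      fun ⟨Y, hY, hw⟩ => ⟨hw.trans hY.1, (card_le_card hw).trans hY.2⟩⟩
  rw [h]
  refine Set.Finite.isClosed_biUnion (Finset.finite_toSet _) fun Y _ => ?_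
  simp only [Set.ofPred_forall]
  refine isClosed_iInter fun i => isClosed_iInter fun _ => ?_
  exact isClosed_eq (by fun_prop) continuous_const

/-- A continuous restricted strongly concave function attains its maximum over the sparse vectors
supported on a given set. -/
theorem isGreatest_supportValue {V : Type*} [Fintype V] [DecidableEq V] {s : ℕ}
    {v : EuclideanSpace ℝ V → ℝ} {m : ℝ} (hm : 0 < m) (hv : Continuous v)
    (hconc : RestrictedStronglyConcave v (OmegaSet V s s) m) (Z : Finset V) :
    IsGreatest (v '' sparseOn s Z) (supportValue s v Z) := by
  -- Beyond this radius the term `-(m/2)‖z‖²` outweighs the linear term at the origin, so `v z ≤ v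
  -- 0` and a maximum over the compact ball is global.
  set R : ℝ := 2 * ‖gradient v 0‖ / m with hR
  have hR0 : 0 ≤ R := by positivity
  have hcomp : IsCompact (sparseOn s Z ∩ Metric.closedBall (0 : EuclideanSpace ℝ V) R) :=
    (isCompact_closedBall _ _).inter_left (isClosed_sparseOn s Z)
  obtain ⟨w, hw, hmax⟩ := hcomp.exists_isMaxOn
    ⟨0, zero_mem_sparseOn s Z, by simpa using hR0⟩ hv.continuousOn
  have hle : ∀ z ∈ sparseOn s Z, v z ≤ v w := by
    intro z hz
    by_cases hzR : ‖z‖ ≤ R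
    · exact hmax ⟨hz, by simpa using hzR⟩
    · have h0 : v 0 ≤ v w := hmax ⟨zero_mem_sparseOn s Z, by simpa using hR0⟩
      have h1 := hconc 0 z (zero_pair_mem_OmegaSet hz.2)
      simp only [sub_zero] at h1
      have h2 := real_inner_le_norm (gradient v 0) z
      have h3 : 2 * ‖gradient v 0‖ < ‖z‖ * m := by
        rw [not_le, hR, div_lt_iff₀ hm] at hzR
        exact hzR
      nlinarith [norm_nonneg z]
  have hg : IsGreatest (v '' sparseOn s Z) (v w) :=
    ⟨⟨w, hw.1, rfl⟩, by rintro _ ⟨z, hz, rfl⟩; exact hle z hz⟩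
  rw [supportValue, hg.csSup_eq]
  exact hg

theorem supportValue_empty {V : Type*} [Fintype V] (s : ℕ) (v : EuclideanSpace ℝ V → ℝ) :
    supportValue s v ∅ = v 0 := by
  have h : sparseOn s (∅ : Finset V) = {0} := by
    ext w
    constructor
    · rintro ⟨hw, -⟩
      ext i
      exact vecSupp_subset_iff.1 hw i (by simp)
    · rintro rfl
      exact zero_mem_sparseOn s ∅
  simp [supportValue, h]

/-! ### Gains of supports and the gradient at the origin -/

theorem inner_eq_sum_of_vecSupp_subset {V : Type*} [Fintype V] {w : EuclideanSpace ℝ V}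
    {Z : Finset V} (hw : vecSupp w ⊆ Z) (g : EuclideanSpace ℝ V) :
    inner ℝ g w = ∑ a ∈ Z, g a * w a := by
  rw [vecSupp_subset_iff] at hw
  rw [PiLp.inner_apply]
  symm
  refine (Finset.sum_subset (subset_univ Z) fun i _ hi => by simp [hw i hi]).trans ?_
  exact Finset.sum_congr rfl fun i _ => by simp [mul_comm]

theorem norm_sq_eq_sum_of_vecSupp_subset {V : Type*} [Fintype V] {w : EuclideanSpace ℝ V}
    {Z : Finset V} (hw : vecSupp w ⊆ Z) : ‖w‖ ^ 2 = ∑ a ∈ Z, w a ^ 2 := by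
  rw [← real_inner_self_eq_norm_sq, inner_eq_sum_of_vecSupp_subset hw]
  exact Finset.sum_congr rfl fun i _ => by ring

/-- Restricted strong concavity bounds the gain of a support by the squared norm of the gradient
at the origin, restricted to that support. -/
theorem supportValue_sub_le {V : Type*} [Fintype V] [DecidableEq V] {s r : ℕ}
    {v : EuclideanSpace ℝ V → ℝ} {m : ℝ} (hm : 0 < m)
    (hconc : RestrictedStronglyConcave v (OmegaSet V r r) m) {Z : Finset V}
    (hatt : IsGreatest (v '' sparseOn s Z) (supportValue s v Z)) (hZ : Z.card ≤ r) :
    supportValue s v Z - supportValue s v ∅ ≤ (∑ a ∈ Z, gradient v 0 a ^ 2) / (2 * m) := by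
  obtain ⟨w, hw, hwv⟩ := hatt.1
  rw [supportValue_empty, ← hwv, Finset.sum_div]
  have h1 := hconc 0 w (zero_pair_mem_OmegaSet ((card_le_card hw.1).trans hZ))
  rw [sub_zero, inner_eq_sum_of_vecSupp_subset hw.1, norm_sq_eq_sum_of_vecSupp_subset hw.1,
    Finset.mul_sum] at h1
  -- The quadratic model separates over coordinates; complete the square in each.
  have h2 : ∑ a ∈ Z, gradient v 0 a * w a + ∑ a ∈ Z, -(m / 2) * w a ^ 2
      ≤ ∑ a ∈ Z, gradient v 0 a ^ 2 / (2 * m) := by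
    rw [← Finset.sum_add_distrib]
    refine Finset.sum_le_sum fun a _ => ?_
    rw [le_div_iff₀ (by positivity)]
    nlinarith [sq_nonneg (gradient v 0 a - m * w a)]
  linarith

/-- Restricted smoothness bounds the gain of a support from below by the squared norm of the
gradient at the origin, restricted to that support. -/
theorem le_supportValue_sub {V : Type*} [Fintype V] [DecidableEq V] {s r : ℕ}
    {v : EuclideanSpace ℝ V → ℝ} {M : ℝ} (hM : 0 < M)
    (hsmooth : RestrictedSmooth v (OmegaSet V r r) M) {Z : Finset V}
    (hatt : IsGreatest (v '' sparseOn s Z) (supportValue s v Z)) (hZ : Z.card ≤ r) (hrs : r ≤ s) :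
    (∑ a ∈ Z, gradient v 0 a ^ 2) / (2 * M) ≤ supportValue s v Z - supportValue s v ∅ := by
  -- The maximiser of the lower quadratic model over vectors supported on `Z`: a gradient step of
  -- length `1/M`.
  set w : EuclideanSpace ℝ V :=
    WithLp.toLp 2 fun a => if a ∈ Z then gradient v 0 a / M else 0 with hwdef
  have hw : vecSupp w ⊆ Z := vecSupp_subset_iff.2 fun i hi => by simp [hwdef, hi]
  have hle : v w ≤ supportValue s v Z :=
    hatt.2 ⟨w, ⟨hw, (card_le_card hw).trans (hZ.trans hrs)⟩, rfl⟩
  have h1 := hsmooth 0 w (zero_pair_mem_OmegaSet ((card_le_card hw).trans hZ))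
  rw [sub_zero, inner_eq_sum_of_vecSupp_subset hw, norm_sq_eq_sum_of_vecSupp_subset hw,
    Finset.mul_sum] at h1
  have h2 : ∑ a ∈ Z, gradient v 0 a * w a + ∑ a ∈ Z, -(M / 2) * w a ^ 2
      = (∑ a ∈ Z, gradient v 0 a ^ 2) / (2 * M) := by
    rw [← Finset.sum_add_distrib, Finset.sum_div]
    refine Finset.sum_congr rfl fun a ha => ?_
    have : w a = gradient v 0 a / M := by simp [hwdef, ha]
    rw [this]
    field_simp
    ring
  rw [supportValue_empty]
  linarith

/-- The two bounds are compared at the pair of the origin and a unit coordinate vector. This is what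
yields `α ≤ 1`. -/
theorem concavity_le_smoothness {V : Type*} [Fintype V] [DecidableEq V] [Nonempty V] {r : ℕ}
    (hr : 1 ≤ r) {v : EuclideanSpace ℝ V → ℝ} {m M : ℝ}
    (hconc : RestrictedStronglyConcave v (OmegaSet V r r) m)
    (hsmooth : RestrictedSmooth v (OmegaSet V r r) M) : m ≤ M := by
  obtain ⟨a⟩ := ‹Nonempty V›
  set w : EuclideanSpace ℝ V := EuclideanSpace.single a 1 with hwdef
  have hw : vecSupp w ⊆ {a} := vecSupp_subset_iff.2 fun i hi => by
    simp only [Finset.mem_singleton] at hi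
    simp [hwdef, hi]
  have hmem := zero_pair_mem_OmegaSet (((card_le_card hw).trans (by simp)).trans hr)
  have h := (hsmooth 0 w hmem).trans (hconc 0 w hmem)
  have hn : ‖w‖ = 1 := by simp [hwdef]
  rw [sub_zero, hn] at h
  linarith

/-! ### Maxima over small subsets, and submodularity for additive weights -/

theorem le_maxSparse {V : Type*} [DecidableEq V] {s : ℕ} {f : Finset V → ℝ} {X Z : Finset V}
    (hZ : Z ⊆ X) (hcard : Z.card ≤ s) : f Z ≤ maxSparse s f X :=
  Finset.le_sup' f (by simp [hZ, hcard])

theorem exists_maxSparse_eq {V : Type*} [DecidableEq V] (s : ℕ) (f : Finset V → ℝ)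
    (X : Finset V) : ∃ Z ⊆ X, Z.card ≤ s ∧ maxSparse s f X = f Z := by
  obtain ⟨Z, hZ, h⟩ := Finset.exists_mem_eq_sup' (s := X.powerset.filter fun Z => Z.card ≤ s)
    ⟨∅, by simp⟩ f
  simp only [Finset.mem_filter, Finset.mem_powerset] at hZ
  exact ⟨Z, hZ.1, hZ.2, h⟩

theorem maxSparse_mono {V : Type*} [DecidableEq V] (s : ℕ) (f : Finset V → ℝ) :
    Monotone (maxSparse s f) := by
  intro X Y hXY
  obtain ⟨Z, hZ, hc, h⟩ := exists_maxSparse_eq s f X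
  rw [h]
  exact le_maxSparse (hZ.trans hXY) hc

theorem maxSparse_empty {V : Type*} [DecidableEq V] (s : ℕ) (f : Finset V → ℝ) :
    maxSparse s f ∅ = f ∅ := by
  obtain ⟨Z, hZ, -, h⟩ := exists_maxSparse_eq s f ∅
  rw [h, Finset.subset_empty.1 hZ]

/-- Erasing `a` from an optimal set leaves a competitor for `X`. This bounds the gains fed to the
hedge subroutines. -/
theorem maxSparse_sum_insert_le {V : Type*} [DecidableEq V] (s : ℕ) {w : V → ℝ}
    (hw : ∀ a, 0 ≤ w a) (a : V) (X : Finset V) :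
    maxSparse s (fun Z => ∑ b ∈ Z, w b) (insert a X)
      ≤ maxSparse s (fun Z => ∑ b ∈ Z, w b) X + w a := by
  obtain ⟨Z, hZ, hc, h⟩ := exists_maxSparse_eq s (fun Z => ∑ b ∈ Z, w b) (insert a X)
  rw [h]
  have h1 : ∑ b ∈ Z.erase a, w b ≤ maxSparse s (fun Z => ∑ b ∈ Z, w b) X :=
    le_maxSparse (f := fun Z => ∑ b ∈ Z, w b) (Finset.subset_insert_iff.1 hZ)
      ((card_le_card (erase_subset a Z)).trans hc)
  have h2 : ∑ b ∈ Z, w b ≤ ∑ b ∈ insert a (Z.erase a), w b :=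
    Finset.sum_le_sum_of_subset_of_nonneg (Finset.insert_erase_subset a Z) fun b _ _ => hw b
  rw [Finset.sum_insert (Finset.notMem_erase a Z)] at h2
  linarith

/-- The largest weight of an `s`-subset is attained at a set of exactly `s` elements above
a threshold, the least of its weights. -/
theorem exists_threshold {V : Type*} [DecidableEq V] {s : ℕ} (hs : 1 ≤ s) {w : V → ℝ}
    (hw : ∀ a, 0 ≤ w a) {X : Finset V} (hX : s ≤ X.card) :
    ∃ W ⊆ X, W.card = s ∧ maxSparse s (fun Z => ∑ b ∈ Z, w b) X = ∑ b ∈ W, w b ∧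
      ∃ b ∈ W, (∀ c ∈ W, w b ≤ w c) ∧ ∀ x ∈ X, x ∉ W → w x ≤ w b := by
  obtain ⟨W₀, hW₀, hc₀, h₀⟩ := exists_maxSparse_eq s (fun Z => ∑ b ∈ Z, w b) X
  -- Padding an optimal set to exactly `s` elements keeps it optimal, since weights are nonnegative.
  obtain ⟨W, hW₀W, hWX, hcard⟩ := Finset.exists_subsuperset_card_eq hW₀ hc₀ hX
  have hmax : maxSparse s (fun Z => ∑ b ∈ Z, w b) X = ∑ b ∈ W, w b := by
    apply le_antisymm
    · rw [h₀]
      exact Finset.sum_le_sum_of_subset_of_nonneg hW₀W fun b _ _ => hw b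
    · exact le_maxSparse (f := fun Z => ∑ b ∈ Z, w b) hWX hcard.le
  have hne : W.Nonempty := Finset.card_pos.1 (by omega)
  obtain ⟨b, hb, hmin⟩ := W.exists_min_image w hne
  refine ⟨W, hWX, hcard, hmax, b, hb, hmin, fun x hx hxW => ?_⟩
  have hx' : x ∉ W.erase b := fun h => hxW (Finset.mem_of_mem_erase h)
  -- Exchange: replacing the lightest element `b` by `x` cannot improve the optimal `W`.
  have h1 : ∑ c ∈ insert x (W.erase b), w c ≤ maxSparse s (fun Z => ∑ b ∈ Z, w b) X := by
    refine le_maxSparse (f := fun Z => ∑ b ∈ Z, w b)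
      (Finset.insert_subset hx ((erase_subset b W).trans hWX)) ?_
    rw [Finset.card_insert_of_notMem hx', Finset.card_erase_of_mem hb]
    omega
  rw [Finset.sum_insert hx', hmax, ← Finset.add_sum_erase W w hb] at h1
  linarith

/-- Submodularity of the largest weight of a subset of size at most `s`. -/
theorem maxSparse_sum_union_le {V : Type*} [DecidableEq V] {s : ℕ} (hs : 1 ≤ s) {w : V → ℝ}
    (hw : ∀ a, 0 ≤ w a) (X Y : Finset V) :
    maxSparse s (fun Z => ∑ b ∈ Z, w b) (X ∪ Y) ≤ maxSparse s (fun Z => ∑ b ∈ Z, w b) X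
      + ∑ a ∈ Y, (maxSparse s (fun Z => ∑ b ∈ Z, w b) (insert a X)
        - maxSparse s (fun Z => ∑ b ∈ Z, w b) X) := by
  set G := maxSparse s (fun Z => ∑ b ∈ Z, w b) with hG
  have hmono : Monotone G := maxSparse_mono s _
  have hsub : ∑ a ∈ Y \ X, (G (insert a X) - G X) ≤ ∑ a ∈ Y, (G (insert a X) - G X) :=
    Finset.sum_le_sum_of_subset_of_nonneg sdiff_subset fun a _ _ =>
      sub_nonneg.2 (hmono (subset_insert a X))
  refine le_trans ?_ (add_le_add_right hsub (G X))
  obtain ⟨Z, hZ, hZc, hGZ⟩ := exists_maxSparse_eq s (fun Z => ∑ b ∈ Z, w b) (X ∪ Y)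
  rw [hG, hGZ, ← hG]
  rcases lt_or_ge X.card s with hlt | hge
  -- There is still room for one more element, so a new atom contributes its full weight.
  · have h1 : ∀ a ∈ Y \ X, w a ≤ G (insert a X) - G X := by
      intro a ha
      have haX : a ∉ X := (Finset.mem_sdiff.1 ha).2
      obtain ⟨U, hU, -, hGU⟩ := exists_maxSparse_eq s (fun Z => ∑ b ∈ Z, w b) X
      have h2 : G X ≤ ∑ b ∈ X, w b := by
        rw [hG, hGU]
        exact Finset.sum_le_sum_of_subset_of_nonneg hU fun b _ _ => hw b
      have h3 : ∑ b ∈ insert a X, w b ≤ G (insert a X) :=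
        le_maxSparse (f := fun Z => ∑ b ∈ Z, w b) (Subset.refl _)
          (by rw [Finset.card_insert_of_notMem haX]; omega)
      rw [Finset.sum_insert haX] at h3
      linarith
    have h2 : ∑ b ∈ X, w b ≤ G X :=
      le_maxSparse (f := fun Z => ∑ b ∈ Z, w b) (Subset.refl _) hlt.le
    calc ∑ b ∈ Z, w b ≤ ∑ b ∈ X ∪ Y, w b :=
          Finset.sum_le_sum_of_subset_of_nonneg hZ fun b _ _ => hw b
      _ = ∑ b ∈ X, w b + ∑ b ∈ Y \ X, w b := by
          rw [← Finset.union_sdiff_self_eq_union, Finset.sum_union Finset.disjoint_sdiff]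
      _ ≤ _ := add_le_add h2 (Finset.sum_le_sum h1)
  · obtain ⟨W, hWX, hWc, hGW, b, hb, hmin, hout⟩ := exists_threshold hs hw hge
    -- The budget is full: a new atom can replace the threshold element `b`.
    have h1 : ∀ a ∈ Y \ X, max (w a - w b) 0 ≤ G (insert a X) - G X := by
      intro a ha
      have haX : a ∉ X := (Finset.mem_sdiff.1 ha).2
      refine max_le ?_ (sub_nonneg.2 (hmono (subset_insert a X)))
      have ha' : a ∉ W.erase b := fun h => haX (hWX (Finset.mem_of_mem_erase h))
      have h3 : ∑ c ∈ insert a (W.erase b), w c ≤ G (insert a X) := by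
        refine le_maxSparse (f := fun Z => ∑ b ∈ Z, w b)
          (Finset.insert_subset_insert a ((erase_subset b W).trans hWX)) ?_
        rw [Finset.card_insert_of_notMem ha', Finset.card_erase_of_mem hb]
        omega
      rw [Finset.sum_insert ha'] at h3
      rw [hG, hGW, ← hG, ← Finset.add_sum_erase W w hb]
      linarith
    -- Measure weights above the threshold. The cardinality bound on `Z` costs at most `s * w b`;
    -- the positive excesses may then be summed over all of `X ∪ Y`, and on `X` they live on `W`.
    have hcount : ∀ U : Finset V, ∑ c ∈ U, w c = ∑ c ∈ U, (w c - w b) + U.card * w b := by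
      intro U
      simp [Finset.sum_sub_distrib]
    have hX : ∑ c ∈ X, max (w c - w b) 0 = ∑ c ∈ W, (w c - w b) := by
      rw [← Finset.sum_subset hWX]
      · exact Finset.sum_congr rfl fun c hc => max_eq_left (sub_nonneg.2 (hmin c hc))
      · intro x hx hxW
        exact max_eq_right (sub_nonpos.2 (hout x hx hxW))
    have h4 : (Z.card : ℝ) * w b ≤ s * w b :=
      mul_le_mul_of_nonneg_right (by exact_mod_cast hZc) (hw b)
    calc ∑ c ∈ Z, w c = ∑ c ∈ Z, (w c - w b) + Z.card * w b := hcount Z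
      _ ≤ ∑ c ∈ Z, max (w c - w b) 0 + s * w b :=
          add_le_add (Finset.sum_le_sum fun c _ => le_max_left _ _) h4
      _ ≤ ∑ c ∈ X ∪ Y, max (w c - w b) 0 + s * w b := by
          gcongr
      _ = ∑ c ∈ W, w c + ∑ c ∈ Y \ X, max (w c - w b) 0 := by
          rw [← Finset.union_sdiff_self_eq_union, Finset.sum_union Finset.disjoint_sdiff, hX,
            hcount W, hWc]
          ring
      _ ≤ G X + ∑ a ∈ Y \ X, (G (insert a X) - G X) :=
          add_le_add hGW.ge (Finset.sum_le_sum h1)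

/-! ### Initial segments of `Fin n` -/

theorem Fin.filter_val_lt_succ {n j : ℕ} (hj : j < n) :
    (univ.filter fun i : Fin n => i.val < j + 1)
      = insert ⟨j, hj⟩ (univ.filter fun i : Fin n => i.val < j) := by
  ext i
  simp only [Finset.mem_filter, Finset.mem_univ, true_and, Finset.mem_insert, Fin.ext_iff]
  omega

theorem Fin.sum_filter_val_lt_succ {n j : ℕ} (hj : j < n) (f : Fin n → ℝ) :
    ∑ i with i.val < j + 1, f i = f ⟨j, hj⟩ + ∑ i with i.val < j, f i := by
  rw [Fin.filter_val_lt_succ hj, Finset.sum_insert (by simp)]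

theorem Fin.filter_val_lt_eq_Iio {n : ℕ} (t : Fin n) :
    (univ.filter fun i : Fin n => i.val < t.val) = Finset.Iio t := by
  ext i
  simp

theorem Fin.filter_val_lt_self (n : ℕ) : (univ.filter fun i : Fin n => i.val < n) = univ := by
  ext i
  simp

/-! ### The hedge algorithm on a fixed sequence of gains -/

/-- Invert the lower bound for `exp (-y)` and use `(1 + y + y²/2)(1 - y + y²/2) = 1 + y⁴/4 ≥ 1`. -/
theorem exp_le_quadratic_of_nonpos {y : ℝ} (hy : y ≤ 0) : Real.exp y ≤ 1 + y + y ^ 2 / 2 := by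
  have h := Real.quadratic_le_exp_of_nonneg (x := -y) (by linarith)
  have hpos : 0 < 1 + -y + (-y) ^ 2 / 2 := by nlinarith
  rw [← neg_neg y, Real.exp_neg]
  refine (inv_anti₀ hpos h).trans ?_
  rw [inv_le_iff_one_le_mul₀ hpos]
  nlinarith [sq_nonneg (y ^ 2)]

/-- The exponential moment of a gain in `[0, Δ]`. -/
theorem sum_mul_exp_le {V : Type*} [Fintype V] {p g : V → ℝ} {η Δ : ℝ} (hη : 0 ≤ η)
    (hp : ∀ a, 0 ≤ p a) (hp1 : ∑ a, p a = 1) (hg0 : ∀ a, 0 ≤ g a) (hgΔ : ∀ a, g a ≤ Δ) :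
    ∑ a, p a * Real.exp (η * g a) ≤ Real.exp (η * ∑ a, p a * g a + η ^ 2 * Δ ^ 2 / 2) := by
  -- Recentring the gains at `Δ` makes the exponent nonpositive, so the quadratic bound needs no
  -- smallness of `η * Δ`.
  have h1 : ∀ a, Real.exp (η * g a)
      ≤ Real.exp (η * Δ) * (1 + η * (g a - Δ) + η ^ 2 * Δ ^ 2 / 2) := by
    intro a
    have hy : η * (g a - Δ) ≤ 0 := mul_nonpos_of_nonneg_of_nonpos hη (by linarith [hgΔ a])
    have h2 := exp_le_quadratic_of_nonpos hy
    have h3 : (η * (g a - Δ)) ^ 2 ≤ η ^ 2 * Δ ^ 2 := by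
      rw [mul_pow]
      have : (g a - Δ) ^ 2 ≤ Δ ^ 2 := by nlinarith [hg0 a, hgΔ a]
      gcongr
    have h4 : η * g a = η * Δ + η * (g a - Δ) := by ring
    rw [h4, Real.exp_add]
    gcongr
    linarith
  calc ∑ a, p a * Real.exp (η * g a)
      ≤ ∑ a, p a * (Real.exp (η * Δ) * (1 + η * (g a - Δ) + η ^ 2 * Δ ^ 2 / 2)) :=
        Finset.sum_le_sum fun a _ => mul_le_mul_of_nonneg_left (h1 a) (hp a)
    _ = Real.exp (η * Δ) * ((1 - η * Δ + η ^ 2 * Δ ^ 2 / 2) * ∑ a, p a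
          + η * ∑ a, p a * g a) := by
        simp only [Finset.mul_sum, ← Finset.sum_add_distrib]
        exact Finset.sum_congr rfl fun a _ => by ring
    _ ≤ Real.exp (η * Δ) * Real.exp (η * ∑ a, p a * g a + η ^ 2 * Δ ^ 2 / 2 - η * Δ) := by
        gcongr
        rw [hp1]
        refine le_trans (le_of_eq ?_) (Real.add_one_le_exp _)
        ring
    _ = _ := by
        rw [← Real.exp_add]
        ring_nf

/-- The regret of exponential weights with learning rate `η` against a fixed expert. -/
theorem exponential_weights_regret {V : Type*} [Fintype V] [Nonempty V] {T : ℕ}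
    (δ : Fin T → V → ℝ) {η Δ : ℝ} (hη : 0 ≤ η)
    (hδ0 : ∀ t a, 0 ≤ δ t a) (hδΔ : ∀ t a, δ t a ≤ Δ) (p : Fin T → V → ℝ)
    (hp : ∀ t a, p t a = Real.exp (η * ∑ τ ∈ Finset.Iio t, δ τ a)
      / ∑ b, Real.exp (η * ∑ τ ∈ Finset.Iio t, δ τ b)) (c : V) :
    η * (∑ t, δ t c - ∑ t, ∑ a, p t a * δ t a)
      ≤ Real.log (Fintype.card V) + T * (η ^ 2 * Δ ^ 2 / 2) := by
  have hpos : ∀ t : Fin T, 0 < ∑ b, Real.exp (η * ∑ τ ∈ Finset.Iio t, δ τ b) := fun t =>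
    Finset.sum_pos (fun b _ => Real.exp_pos _) Finset.univ_nonempty
  -- The potential is the total weight: round `j` multiplies it by the exponential moment of the
  -- gain under `p`.
  have key : ∀ j ≤ T, ∑ a, Real.exp (η * ∑ τ : Fin T with τ.val < j, δ τ a)
      ≤ Fintype.card V * Real.exp (∑ τ : Fin T with τ.val < j,
        (η * ∑ a, p τ a * δ τ a + η ^ 2 * Δ ^ 2 / 2)) := by
    intro j
    induction j with
    | zero => simp
    | succ j ih =>
      intro hj
      have hj' : j < T := hj
      have hIio := Fin.filter_val_lt_eq_Iio (⟨j, hj'⟩ : Fin T)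
      simp only at hIio
      have hw : ∀ a, Real.exp (η * ∑ τ : Fin T with τ.val < j + 1, δ τ a)
          = (∑ b, Real.exp (η * ∑ τ : Fin T with τ.val < j, δ τ b))
            * (p ⟨j, hj'⟩ a * Real.exp (η * δ ⟨j, hj'⟩ a)) := by
        intro a
        rw [Fin.sum_filter_val_lt_succ hj', hp, mul_add, Real.exp_add, hIio]
        field_simp [(hpos ⟨j, hj'⟩).ne']
      simp only [hw, ← Finset.mul_sum]
      rw [Fin.sum_filter_val_lt_succ hj', add_comm, Real.exp_add, ← mul_assoc]
      refine mul_le_mul (ih hj'.le) ?_ (Finset.sum_nonneg fun a _ => ?_) (by positivity)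
      · refine sum_mul_exp_le hη (fun a => ?_) ?_ (hδ0 _) (hδΔ _)
        · rw [hp]
          exact div_nonneg (Real.exp_pos _).le (hpos _).le
        · simp only [hp, ← Finset.sum_div]
          exact div_self (hpos _).ne'
      · rw [hp]
        exact mul_nonneg (div_nonneg (Real.exp_pos _).le (hpos _).le) (Real.exp_pos _).le
  have h := key T le_rfl
  simp only [Fin.filter_val_lt_self] at h
  have h1 : Real.exp (η * ∑ t, δ t c) ≤ ∑ a, Real.exp (η * ∑ t, δ t a) :=
    Finset.single_le_sum (f := fun a => Real.exp (η * ∑ t, δ t a))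
      (fun a _ => (Real.exp_pos _).le) (Finset.mem_univ c)
  have h2 := Real.log_le_log (Real.exp_pos _) (h1.trans h)
  have hcard : (Fintype.card V : ℝ) ≠ 0 := by simp
  rw [Real.log_exp, Real.log_mul hcard (Real.exp_pos _).ne', Real.log_exp,
    Finset.sum_add_distrib, ← Finset.mul_sum] at h2
  simp only [Finset.sum_const, Finset.card_univ, Fintype.card_fin, nsmul_eq_mul] at h2
  linarith

/-- The regret of exponential weights with the learning rate `hedgeRate`. -/
theorem hedgeRate_regret {V : Type*} [Fintype V] [Nonempty V] {T : ℕ}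
    (δ : Fin T → V → ℝ) {Δ : ℝ} (hΔ : 0 ≤ Δ)
    (hδ0 : ∀ t a, 0 ≤ δ t a) (hδΔ : ∀ t a, δ t a ≤ Δ) (p : Fin T → V → ℝ)
    (hp : ∀ t a, p t a = Real.exp (hedgeRate (Fintype.card V) T Δ * ∑ τ ∈ Finset.Iio t, δ τ a)
      / ∑ b, Real.exp (hedgeRate (Fintype.card V) T Δ * ∑ τ ∈ Finset.Iio t, δ τ b)) (c : V) :
    ∑ t, δ t c - ∑ t, ∑ a, p t a * δ t a
      ≤ Δ * Real.sqrt (2 * T * Real.log (Fintype.card V)) := by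
  -- Degenerate cases, where the rate is `0` and cannot be divided out: zero gains, no rounds, or a
  -- single expert.
  rcases hΔ.eq_or_lt with rfl | hΔpos
  · have h0 : ∀ t a, δ t a = 0 := fun t a => le_antisymm (hδΔ t a) (hδ0 t a)
    simp [h0]
  rcases Nat.eq_zero_or_pos T with rfl | hT
  · simp
  have hcard : 1 ≤ Fintype.card V := Fintype.card_pos
  rcases hcard.eq_or_lt with h1 | h1
  · have hsub : Subsingleton V := Fintype.card_le_one_iff_subsingleton.1 h1.ge
    have hu : (univ : Finset V) = {c} := by
      ext a
      simp [Subsingleton.elim a c]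
    have hp1 : ∀ t, p t c = 1 := by
      intro t
      rw [hp, hu, Finset.sum_singleton]
      exact div_self (Real.exp_pos _).ne'
    simp [hu, hp1, ← h1]
  set L := Real.log (Fintype.card V) with hL
  have hLpos : 0 < L := Real.log_pos (by exact_mod_cast h1)
  have hTpos : (0 : ℝ) < T := by exact_mod_cast hT
  set η := hedgeRate (Fintype.card V) T Δ with hη
  have hηpos : 0 < η := div_pos (Real.sqrt_pos.2 (by positivity)) hΔpos
  have hreg := exponential_weights_regret δ hηpos.le hδ0 hδΔ p hp c
  rw [← hL] at hreg
  -- The rate balances the two terms of the regret bound: each equals `L`.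
  have hηΔ : (η * Δ) ^ 2 * T = 2 * L := by
    rw [hη, hedgeRate, div_mul_cancel₀ _ hΔpos.ne', Real.sq_sqrt (by positivity), ← hL]
    field_simp
  have hsqrt : Real.sqrt (2 * T * L) = η * Δ * T := by
    rw [← Real.sqrt_sq (by positivity : 0 ≤ η * Δ * T)]
    congr 1
    linear_combination -(T : ℝ) * hηΔ
  rw [hsqrt]
  refine le_of_mul_le_mul_left (hreg.trans (le_of_eq ?_)) hηpos
  linear_combination -(1 / 2) * hηΔ

/-! ### Expectations over trajectories -/

theorem trajExp_add {V : Type*} [Fintype V] [DecidableEq V] {T k : ℕ} (F : Fin T → Finset V → ℝ)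
    (η : ℝ) (φ ψ : (Fin T → Fin k → V) → ℝ) :
    trajExp F η (fun ω => φ ω + ψ ω) = trajExp F η φ + trajExp F η ψ := by
  simp [trajExp, mul_add, Finset.sum_add_distrib]

theorem trajExp_const_mul {V : Type*} [Fintype V] [DecidableEq V] {T k : ℕ}
    (F : Fin T → Finset V → ℝ) (η c : ℝ) (φ : (Fin T → Fin k → V) → ℝ) :
    trajExp F η (fun ω => c * φ ω) = c * trajExp F η φ := by
  simp only [trajExp, Finset.mul_sum]
  exact Finset.sum_congr rfl fun ω _ => by ring

theorem trajExp_const {V : Type*} [Fintype V] [DecidableEq V] [Nonempty V] {T k : ℕ}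
    (F : Fin T → Finset V → ℝ) (η c : ℝ) :
    trajExp F η (fun _ : Fin T → Fin k → V => c) = c := by
  simp only [trajExp, ← Finset.sum_mul, trajProb_sum, one_mul]

theorem trajExp_mono {V : Type*} [Fintype V] [DecidableEq V] {T k : ℕ}
    (F : Fin T → Finset V → ℝ) (η : ℝ) {φ ψ : (Fin T → Fin k → V) → ℝ} (h : ∀ ω, φ ω ≤ ψ ω) :
    trajExp F η φ ≤ trajExp F η ψ :=
  Finset.sum_le_sum fun ω _ => mul_le_mul_of_nonneg_left (h ω) (trajProb_nonneg F η ω)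

/-- Conditioning on all rounds but the last one. -/
theorem trajExp_succ {V : Type*} [Fintype V] [DecidableEq V] {T k : ℕ}
    (F : Fin (T + 1) → Finset V → ℝ) (η : ℝ) (φ : (Fin (T + 1) → Fin k → V) → ℝ) :
    trajExp F η φ = trajExp (fun τ => F τ.castSucc) η fun ω : Fin T → Fin k → V =>
      ∑ r : Fin k → V, (∏ i, hedgeProb F η
        (Fin.snoc ω r : Fin (T + 1) → Fin k → V) (Fin.last T) i (r i)) * φ (Fin.snoc ω r) := by
  unfold trajExp
  rw [← (Fin.snocEquiv fun _ : Fin (T + 1) => Fin k → V).sum_comp, Fintype.sum_prod_type,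
    Finset.sum_comm]
  refine Finset.sum_congr rfl fun ω _ => ?_
  rw [Finset.mul_sum]
  refine Finset.sum_congr rfl fun r _ => ?_
  rw [← mul_assoc]
  simp only [Fin.snocEquiv, Equiv.coe_fn_mk]
  congr 1
  unfold trajProb
  rw [Fin.prod_univ_castSucc]
  simp only [Fin.snoc_last, Fin.snoc_castSucc, hedgeProb_snoc_castSucc]

/-- Under a product distribution, a coordinate that the gain does not depend on can be averaged
out. -/
theorem sum_prod_mul_apply {V : Type*} [Fintype V] [DecidableEq V] {k : ℕ} (i : Fin k)
    (p : Fin k → V → ℝ) (hp : ∑ a, p i a = 1) (h : (Fin k → V) → V → ℝ)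
    (hh : ∀ r b, h (Function.update r i b) = h r) :
    ∑ r : Fin k → V, (∏ j, p j (r j)) * h r (r i)
      = ∑ r : Fin k → V, (∏ j, p j (r j)) * ∑ a, p i a * h r a := by
  cases k with
  | zero => exact i.elim0
  | succ k =>
    obtain ⟨v, -⟩ : ∃ v : V, p i v ≠ 0 := by
      by_contra! hall
      simp [hall] at hp
    have hindep : ∀ (b : V) (r : Fin k → V),
        h (Fin.insertNthEquiv (fun _ => V) i (b, r)) = h (Fin.insertNth i v r) := by
      intro b r
      rw [← hh (Fin.insertNth i v r) b, Fin.update_insertNth]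
      rfl
    rw [← (Fin.insertNthEquiv (fun _ => V) i).sum_comp,
      ← (Fin.insertNthEquiv (fun _ => V) i).sum_comp, Fintype.sum_prod_type_right,
      Fintype.sum_prod_type_right]
    refine Finset.sum_congr rfl fun r _ => ?_
    simp only [hindep _ r]
    simp only [Fin.insertNthEquiv_apply, Fin.prod_univ_succAbove _ i, Fin.insertNth_apply_same,
      Fin.insertNth_apply_succAbove]
    rw [← Finset.sum_mul, ← Finset.sum_mul, hp, one_mul, Finset.mul_sum]
    exact Finset.sum_congr rfl fun a _ => by ring

/-- The prefix consists of strictly earlier slots, so a slot's gain function is independent of its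
own draw given the past rounds. -/
theorem feedback_update {V : Type*} [DecidableEq V] {k : ℕ} (G : Finset V → ℝ) (r : Fin k → V)
    (i : Fin k) (b : V) : feedback G (Function.update r i b) i = feedback G r i := by
  have h : prefixSet (Function.update r i b) i = prefixSet r i := by
    unfold prefixSet
    refine Finset.image_congr fun j hj => ?_
    exact Function.update_of_ne (Finset.mem_Iio.1 hj).ne _ _
  ext a
  simp [feedback, h]

/-- The expected gain of a subroutine is the expectation of its conditional mean gains. -/
theorem trajExp_sum_feedback {V : Type*} [Fintype V] [DecidableEq V] [Nonempty V] {k : ℕ} (η : ℝ)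
    (i : Fin k) : ∀ {T : ℕ} (F : Fin T → Finset V → ℝ),
    trajExp F η (fun ω : Fin T → Fin k → V => ∑ t, feedback (F t) (ω t) i (ω t i))
      = trajExp F η fun ω : Fin T → Fin k → V =>
        ∑ t, ∑ a, hedgeProb F η ω t i a * feedback (F t) (ω t) i a
  | 0, F => by simp
  | T + 1, F => by
    simp only [Fin.sum_univ_castSucc, trajExp_add]
    congr 1
    -- Terms of earlier rounds ignore the last draws, whose probabilities sum to `1`.
    · rw [trajExp_succ, trajExp_succ]
      simp only [Fin.snoc_castSucc, hedgeProb_snoc_castSucc, ← Finset.sum_mul]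
      have hone : ∀ ω : Fin T → Fin k → V, ∑ r : Fin k → V, ∏ j, hedgeProb F η
          (Fin.snoc ω r : Fin (T + 1) → Fin k → V) (Fin.last T) j (r j) = 1 := by
        intro ω
        obtain ⟨v⟩ := ‹Nonempty V›
        have : Nonempty V := ⟨v⟩
        have h2 := Finset.prod_univ_sum (fun _ : Fin k => (univ : Finset V)) fun j a =>
          hedgeProb F η (Fin.snoc ω (fun _ => v) : Fin (T + 1) → Fin k → V) (Fin.last T) j a
        simp only [hedgeProb_sum, Finset.prod_const_one, Fintype.piFinset_univ] at h2
        rw [h2]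
        exact Finset.sum_congr rfl fun r _ => Finset.prod_congr rfl fun j _ =>
          hedgeProb_snoc_last F η ω r _ j _
      simp only [hone, one_mul]
      exact trajExp_sum_feedback η i fun τ => F τ.castSucc
    -- In the last round the probabilities depend on the past only, so the draws are independent and
    -- slot `i` can be averaged out.
    · rw [trajExp_succ, trajExp_succ]
      congr 1
      ext ω
      obtain ⟨v⟩ := ‹Nonempty V›
      have : Nonempty V := ⟨v⟩
      have hlast : ∀ (r : Fin k → V) (j : Fin k) (a : V), hedgeProb F η
          (Fin.snoc ω r : Fin (T + 1) → Fin k → V) (Fin.last T) j a = hedgeProb F η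
          (Fin.snoc ω (fun _ => v) : Fin (T + 1) → Fin k → V) (Fin.last T) j a :=
        fun r j a => hedgeProb_snoc_last F η ω r _ j a
      simp only [Fin.snoc_last, hlast]
      exact sum_prod_mul_apply i (fun j a => hedgeProb F η
        (Fin.snoc ω (fun _ => v) : Fin (T + 1) → Fin k → V) (Fin.last T) j a)
        (hedgeProb_sum F η _ _ i) (fun r a => feedback (F (Fin.last T)) r i a)
        (fun r b => feedback_update _ r i b)

/-- In expectation, each hedge subroutine has small regret against each fixed element. -/
theorem trajExp_feedback_regret {V : Type*} [Fintype V] [DecidableEq V] [Nonempty V] {T k : ℕ}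
    {F : Fin T → Finset V → ℝ} {Δ : ℝ} (hΔ : 0 ≤ Δ) (hmono : ∀ t, Monotone (F t))
    (hinc : ∀ t a X, F t (insert a X) ≤ F t X + Δ) (i : Fin k) (c : V) :
    trajExp F (hedgeRate (Fintype.card V) T Δ)
        (fun ω : Fin T → Fin k → V => ∑ t, feedback (F t) (ω t) i c)
      ≤ trajExp F (hedgeRate (Fintype.card V) T Δ)
        (fun ω : Fin T → Fin k → V => ∑ t, feedback (F t) (ω t) i (ω t i))
        + Δ * Real.sqrt (2 * T * Real.log (Fintype.card V)) := by
  rw [trajExp_sum_feedback]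
  rw [← trajExp_const (k := k) F (hedgeRate (Fintype.card V) T Δ)
    (Δ * Real.sqrt (2 * T * Real.log (Fintype.card V))), ← trajExp_add]
  -- Along a fixed trajectory the gains form a fixed sequence, so the deterministic hedge bound
  -- applies despite their dependence on past draws.
  refine trajExp_mono F _ fun ω => ?_
  have h := hedgeRate_regret (fun t a => feedback (F t) (ω t) i a) hΔ
    (fun t a => sub_nonneg.2 (hmono t (subset_insert _ _)))
    (fun t a => by
      have := hinc t a (prefixSet (ω t) i)
      simp only [feedback]
      linarith)
    (fun t a => hedgeProb F (hedgeRate (Fintype.card V) T Δ) ω t i a) (fun t a => rfl) c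
  linarith

/-! ### The online greedy algorithm -/

/-- The set of the first `j` picks. -/
def firstPicks {V : Type*} [DecidableEq V] {k : ℕ} (r : Fin k → V) (j : ℕ) : Finset V :=
  (univ.filter fun i : Fin k => i.val < j).image r

theorem firstPicks_val {V : Type*} [DecidableEq V] {k : ℕ} (r : Fin k → V) (i : Fin k) :
    firstPicks r i.val = prefixSet r i := by
  rw [firstPicks, Fin.filter_val_lt_eq_Iio, prefixSet]

theorem firstPicks_succ {V : Type*} [DecidableEq V] {k j : ℕ} (r : Fin k → V) (hj : j < k) :
    firstPicks r (j + 1) = insert (r ⟨j, hj⟩) (firstPicks r j) := by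
  rw [firstPicks, Fin.filter_val_lt_succ hj, Finset.image_insert, firstPicks]

theorem firstPicks_self {V : Type*} [DecidableEq V] {k : ℕ} (r : Fin k → V) :
    firstPicks r k = playedSet r := by
  rw [firstPicks, Fin.filter_val_lt_self, playedSet]

theorem firstPicks_zero {V : Type*} [DecidableEq V] {k : ℕ} (r : Fin k → V) :
    firstPicks r 0 = ∅ := by
  simp [firstPicks]

/-- One step of the online greedy algorithm. -/
theorem greedy_step {V : Type*} [Fintype V] [DecidableEq V] [Nonempty V] {T k : ℕ}
    {F : Fin T → Finset V → ℝ} {Δ : ℝ} (hΔ : 0 ≤ Δ) (hmono : ∀ t, Monotone (F t))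
    (hinc : ∀ t a X, F t (insert a X) ≤ F t X + Δ)
    (hsub : ∀ t X Y, F t (X ∪ Y) ≤ F t X + ∑ a ∈ Y, (F t (insert a X) - F t X))
    {X : Finset V} (hX : X.card ≤ k) {j : ℕ} (hj : j < k) :
    ∑ t, F t X - trajExp F (hedgeRate (Fintype.card V) T Δ)
        (fun ω : Fin T → Fin k → V => ∑ t, F t (firstPicks (ω t) j))
      ≤ k * (trajExp F (hedgeRate (Fintype.card V) T Δ)
          (fun ω : Fin T → Fin k → V => ∑ t, F t (firstPicks (ω t) (j + 1)))
        - trajExp F (hedgeRate (Fintype.card V) T Δ)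
          (fun ω : Fin T → Fin k → V => ∑ t, F t (firstPicks (ω t) j))
        + Δ * Real.sqrt (2 * T * Real.log (Fintype.card V))) := by
  set η := hedgeRate (Fintype.card V) T Δ
  set R := Δ * Real.sqrt (2 * T * Real.log (Fintype.card V)) with hR
  have hR0 : 0 ≤ R := by positivity
  set i : Fin k := ⟨j, hj⟩ with hi
  set E := trajExp F η (fun ω : Fin T → Fin k → V => ∑ t, F t (firstPicks (ω t) j)) with hE
  set E' := trajExp F η (fun ω : Fin T → Fin k → V => ∑ t, F t (firstPicks (ω t) (j + 1)))
    with hE'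
  have hpre : ∀ r : Fin k → V, prefixSet r i = firstPicks r j := fun r =>
    (firstPicks_val r i).symm
  -- The realised gain of slot `j` is the increase in value from `j` to `j + 1` picks.
  have hgain : trajExp F η (fun ω : Fin T → Fin k → V =>
      ∑ t, feedback (F t) (ω t) i (ω t i)) = E' - E := by
    rw [eq_sub_iff_add_eq, hE, hE', ← trajExp_add]
    congr 1
    ext ω
    rw [← Finset.sum_add_distrib]
    refine Finset.sum_congr rfl fun t _ => ?_
    rw [feedback, hpre, firstPicks_succ _ hj]
    ring
  -- Makes the bound per element nonnegative, so that `X.card` may be replaced by `k`.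
  have hEE' : E ≤ E' := by
    refine trajExp_mono F η fun ω => Finset.sum_le_sum fun t _ => hmono t ?_
    rw [firstPicks_succ _ hj]
    exact subset_insert _ _
  have hopt : ∑ t, F t X - E ≤ ∑ c ∈ X, (E' - E + R) := by
    have h1 : ∑ t, F t X ≤ trajExp F η (fun ω : Fin T → Fin k → V =>
        ∑ t, F t (firstPicks (ω t) j) + ∑ c ∈ X, ∑ t, feedback (F t) (ω t) i c) := by
      rw [← trajExp_const (k := k) F η (∑ t, F t X)]
      refine trajExp_mono F η fun ω => ?_
      rw [Finset.sum_comm, ← Finset.sum_add_distrib]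
      refine Finset.sum_le_sum fun t _ => ?_
      simp only [feedback, hpre]
      exact (hmono t subset_union_right).trans (hsub t (firstPicks (ω t) j) X)
    have h2 : trajExp F η (fun ω : Fin T → Fin k → V =>
        ∑ c ∈ X, ∑ t, feedback (F t) (ω t) i c)
        = ∑ c ∈ X, trajExp F η (fun ω : Fin T → Fin k → V =>
          ∑ t, feedback (F t) (ω t) i c) := by
      simp only [trajExp, Finset.mul_sum (s := X)]
      exact Finset.sum_comm
    rw [trajExp_add, h2] at h1
    have h3 : ∀ c ∈ X, trajExp F η (fun ω : Fin T → Fin k → V =>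
        ∑ t, feedback (F t) (ω t) i c) ≤ E' - E + R := by
      intro c _
      have := trajExp_feedback_regret hΔ hmono hinc i c
      rw [hgain] at this
      exact this
    have h4 := Finset.sum_le_sum h3
    linarith
  refine hopt.trans ?_
  rw [Finset.sum_const, nsmul_eq_mul]
  have : (X.card : ℝ) ≤ k := by exact_mod_cast hX
  exact mul_le_mul_of_nonneg_right this (by linarith)

/-- The `(1 - 1/e)`-regret of the online greedy algorithm with hedge subroutines. -/
theorem online_greedy_regret {V : Type*} [Fintype V] [DecidableEq V] [Nonempty V] {T k : ℕ}
    (hk : 1 ≤ k) {F : Fin T → Finset V → ℝ} {Δ : ℝ} (hΔ : 0 ≤ Δ) (hmono : ∀ t, Monotone (F t))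
    (hzero : ∀ t, F t ∅ = 0) (hinc : ∀ t a X, F t (insert a X) ≤ F t X + Δ)
    (hsub : ∀ t X Y, F t (X ∪ Y) ≤ F t X + ∑ a ∈ Y, (F t (insert a X) - F t X))
    {X : Finset V} (hX : X.card ≤ k) :
    (1 - 1 / Real.exp 1) * ∑ t, F t X - trajExp F (hedgeRate (Fintype.card V) T Δ)
        (fun ω : Fin T → Fin k → V => ∑ t, F t (playedSet (ω t)))
      ≤ k * (Δ * Real.sqrt (2 * T * Real.log (Fintype.card V))) := by
  set η := hedgeRate (Fintype.card V) T Δ with hη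
  set R := Δ * Real.sqrt (2 * T * Real.log (Fintype.card V)) with hR
  have hR0 : 0 ≤ R := by positivity
  set O := ∑ t, F t X with hO
  have hO0 : 0 ≤ O := Finset.sum_nonneg fun t _ => by
    rw [← hzero t]
    exact hmono t (empty_subset X)
  set E : ℕ → ℝ := fun j => trajExp F η
    (fun ω : Fin T → Fin k → V => ∑ t, F t (firstPicks (ω t) j)) with hE
  have hkpos : (0 : ℝ) < k := by exact_mod_cast hk
  have hk1 : (1 : ℝ) ≤ k := by exact_mod_cast hk
  have hq0 : (0 : ℝ) ≤ 1 - 1 / k := by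
    rw [sub_nonneg, div_le_one hkpos]
    exact hk1
  have hq1 : (1 - 1 / k : ℝ) ≤ 1 := by
    have : (0 : ℝ) ≤ 1 / k := by positivity
    linarith
  have hstep : ∀ j < k, O - E (j + 1) ≤ (1 - 1 / k) * (O - E j) + R := by
    intro j hj
    have h : O - E j ≤ k * (E (j + 1) - E j + R) := greedy_step hΔ hmono hinc hsub hX hj
    have h' : 1 / (k : ℝ) * (O - E j) ≤ E (j + 1) - E j + R := by
      rw [one_div, inv_mul_le_iff₀ hkpos]
      exact h
    linarith
  -- The errors of earlier slots are also contracted, but bounding that factor by `1` is enough.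
  have hind : ∀ j ≤ k, O - E j ≤ (1 - 1 / k) ^ j * O + j * R := by
    intro j
    induction j with
    | zero => simp [hE, firstPicks_zero, hzero, trajExp]
    | succ j ih =>
      intro hj
      have h1 := mul_le_mul_of_nonneg_left (ih (by omega)) hq0
      have h2 := hstep j (by omega)
      have h3 : (1 - 1 / k : ℝ) * (j * R) ≤ 1 * (j * R) :=
        mul_le_mul_of_nonneg_right hq1 (by positivity)
      push_cast
      rw [pow_succ']
      linarith
  have hlast := hind k le_rfl
  have hexp : (1 - 1 / k : ℝ) ^ k ≤ 1 / Real.exp 1 := by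
    have := Real.one_sub_div_pow_le_exp_neg (n := k) (t := 1) hk1
    rwa [Real.exp_neg, ← one_div] at this
  have hEk : E k = trajExp F η (fun ω : Fin T → Fin k → V => ∑ t, F t (playedSet (ω t))) := by
    simp only [hE, firstPicks_self]
  rw [← hEk]
  have := mul_le_mul_of_nonneg_right hexp hO0
  linarith

/-! ### From the surrogate back to the objective -/

theorem singletonGain_le_maxGain {V : Type*} [Fintype V] {T : ℕ} (f : Fin T → Finset V → ℝ)
    (t : Fin T) (a : V) : singletonGain (f t) a ≤ maxGain f :=
  (le_ciSup (f := fun t => singletonGain (f t) a) (Set.finite_range _).bddAbove t).trans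
    (le_ciSup (f := fun a => ⨆ t, singletonGain (f t) a) (Set.finite_range _).bddAbove a)

/-- The singleton gains are nonnegative, and their sum over a sparse set agrees with the gain of
that set up to the ratios of the concavity and smoothness parameters. -/
theorem objective_sub_bounds {V : Type*} [Fintype V] [DecidableEq V] {s : ℕ} (hs : 1 ≤ s)
    {v : EuclideanSpace ℝ V → ℝ} {m₁ M₁ mₛ Mₛ : ℝ}
    (hm₁ : 0 < m₁) (hmₛ : 0 < mₛ) (hM₁ : 0 < M₁) (hMₛ : 0 < Mₛ)
    (hconc₁ : RestrictedStronglyConcave v (OmegaSet V 1 1) m₁)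
    (hsmooth₁ : RestrictedSmooth v (OmegaSet V 1 1) M₁)
    (hconcₛ : RestrictedStronglyConcave v (OmegaSet V s s) mₛ)
    (hsmoothₛ : RestrictedSmooth v (OmegaSet V s s) Mₛ)
    (hatt : ∀ Z, IsGreatest (v '' sparseOn s Z) (supportValue s v Z)) :
    (∀ a, 0 ≤ singletonGain (supportValue s v) a) ∧
    ∀ X, m₁ / Mₛ * surrogate s v X ≤ objective s v X - v 0 ∧
      objective s v X - v 0 ≤ M₁ / mₛ * surrogate s v X := by
  have hup : ∀ a, singletonGain (supportValue s v) a ≤ gradient v 0 a ^ 2 / (2 * m₁) := by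
    intro a
    simpa [-tsub_le_iff_right, singletonGain] using supportValue_sub_le hm₁ hconc₁ (hatt {a}) (by simp)
  have hlo : ∀ a, gradient v 0 a ^ 2 / (2 * M₁) ≤ singletonGain (supportValue s v) a := by
    intro a
    simpa [singletonGain] using le_supportValue_sub hM₁ hsmooth₁ (hatt {a}) (by simp) hs
  refine ⟨fun a => le_trans (by positivity) (hlo a), fun X => ⟨?_, ?_⟩⟩
  -- An optimal set for the surrogate competes in the objective; the second bullet exchanges the
  -- roles.
  · obtain ⟨Z, hZ, hc, h⟩ := exists_maxSparse_eq s (modularApprox (supportValue s v)) X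
    rw [surrogate, h]
    have h1 := le_supportValue_sub hMₛ hsmoothₛ (hatt Z) hc le_rfl
    rw [supportValue_empty] at h1
    have h2 : supportValue s v Z ≤ objective s v X := le_maxSparse hZ hc
    refine le_trans ?_ (h1.trans (sub_le_sub_right h2 _))
    rw [modularApprox, Finset.mul_sum, Finset.sum_div]
    refine Finset.sum_le_sum fun a _ => ?_
    refine (mul_le_mul_of_nonneg_left (hup a) (by positivity)).trans (le_of_eq ?_)
    field_simp
  · obtain ⟨Z, hZ, hc, h⟩ := exists_maxSparse_eq s (supportValue s v) X
    rw [objective, h]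
    have h1 := supportValue_sub_le hmₛ hconcₛ (hatt Z) hc
    rw [supportValue_empty] at h1
    have h2 : modularApprox (supportValue s v) Z ≤ surrogate s v X := le_maxSparse hZ hc
    refine h1.trans (le_trans ?_ (mul_le_mul_of_nonneg_left h2 (by positivity)))
    rw [modularApprox, Finset.mul_sum, Finset.sum_div]
    refine Finset.sum_le_sum fun a _ => ?_
    refine le_trans (le_of_eq ?_) (mul_le_mul_of_nonneg_left (hlo a) (by positivity))
    field_simp

theorem mainTheorem11 {V : Type*} [Fintype V] [DecidableEq V] [Nonempty V] {d T k s : ℕ}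
    (hs : 1 ≤ s) (hsk : s ≤ k)
    (A : Matrix (Fin d) V ℝ)
    (u : EuclideanSpace ℝ (Fin d) → EuclideanSpace ℝ (Fin d) → ℝ)
    (y : Fin T → EuclideanSpace ℝ (Fin d))
    (hu0 : ∀ t, 0 ≤ u (y t) 0)
    (hdiff : ∀ t, ContDiff ℝ 1 (dataUtility A u (y t)))
    (m₁ M₁ mₛ Mₛ : ℝ) (hm₁ : 0 < m₁) (hmₛ : 0 < mₛ) (hM₁ : 0 < M₁) (hMₛ : 0 < Mₛ)
    (hconc₁ : ∀ t, RestrictedStronglyConcave (dataUtility A u (y t)) (OmegaSet V 1 1) m₁)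
    (hsmooth₁ : ∀ t, RestrictedSmooth (dataUtility A u (y t)) (OmegaSet V 1 1) M₁)
    (hconcₛ : ∀ t, RestrictedStronglyConcave (dataUtility A u (y t)) (OmegaSet V s s) mₛ)
    (hsmoothₛ : ∀ t, RestrictedSmooth (dataUtility A u (y t)) (OmegaSet V s s) Mₛ)
    (α Δmax : ℝ)
    (hα : α = (1 - 1 / Real.exp 1) * (m₁ * mₛ / (M₁ * Mₛ)))
    (hΔ : Δmax = maxGain fun t => supportValue s (dataUtility A u (y t))) :
    (∀ t Z, IsGreatest (dataUtility A u (y t) '' sparseOn s Z)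
        (supportValue s (dataUtility A u (y t)) Z)) ∧
    onlineGreedyRegret k α
        (fun t => objective s (dataUtility A u (y t)))
        (fun t => surrogate s (dataUtility A u (y t)))
        (hedgeRate (Fintype.card V) T Δmax)
      ≤ k * Δmax * m₁ / Mₛ * Real.sqrt (2 * T * Real.log (Fintype.card V)) := by
  have hatt : ∀ t Z, IsGreatest (dataUtility A u (y t) '' sparseOn s Z)
      (supportValue s (dataUtility A u (y t)) Z) := fun t Z =>
    isGreatest_supportValue hmₛ (hdiff t).continuous (hconcₛ t) Z
  refine ⟨hatt, ?_⟩
  unfold onlineGreedyRegret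
  obtain ⟨X, hX, hXeq⟩ := Finset.exists_mem_eq_sup'
    (s := (univ : Finset (Finset V)).filter fun X => X.card ≤ k) ⟨∅, by simp⟩
    (fun X => ∑ t, objective s (dataUtility A u (y t)) X)
  rw [hXeq]
  have hXk : X.card ≤ k := by simpa using hX
  -- With no rounds both sides vanish; otherwise some round supplies `0 ≤ Δmax` and `α ≤ 1`.
  rcases Nat.eq_zero_or_pos T with rfl | hT
  · simp [trajExp]
  have t₀ : Fin T := ⟨0, hT⟩
  have hbounds := fun t => objective_sub_bounds hs hm₁ hmₛ hM₁ hMₛ (hconc₁ t) (hsmooth₁ t)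
    (hconcₛ t) (hsmoothₛ t) (hatt t)
  have hgain_le : ∀ t a,
      singletonGain (supportValue s (dataUtility A u (y t))) a ≤ Δmax := fun t a => by
    rw [hΔ]
    exact singletonGain_le_maxGain (fun t => supportValue s (dataUtility A u (y t))) t a
  have hΔ0 : 0 ≤ Δmax :=
    ((hbounds t₀).1 (Classical.arbitrary V)).trans (hgain_le t₀ (Classical.arbitrary V))
  have h0 : ∀ t, 0 ≤ dataUtility A u (y t) 0 := fun t => by
    have : dataUtility A u (y t) 0 = u (y t) 0 := by simp [dataUtility]
    rw [this]
    exact hu0 t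
  set f₀ := ∑ t, dataUtility A u (y t) 0 with hf₀
  have hf₀0 : 0 ≤ f₀ := Finset.sum_nonneg fun t _ => h0 t
  have he : 0 ≤ 1 - 1 / Real.exp 1 ∧ 1 - 1 / Real.exp 1 ≤ 1 := by
    have h1 : 1 ≤ Real.exp 1 := Real.one_le_exp zero_le_one
    have h2 : 1 / Real.exp 1 ≤ 1 := (div_le_one (Real.exp_pos 1)).2 h1
    have h3 : 0 ≤ 1 / Real.exp 1 := by positivity
    constructor <;> linarith
  have hα0 : 0 ≤ α := by
    rw [hα]
    exact mul_nonneg he.1 (by positivity)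
  have hα1 : α ≤ 1 := by
    rw [hα]
    refine mul_le_one₀ he.2 (by positivity) ?_
    rw [div_le_one (by positivity)]
    exact mul_le_mul (concavity_le_smoothness le_rfl (hconc₁ t₀) (hsmooth₁ t₀))
      (concavity_le_smoothness hs (hconcₛ t₀) (hsmoothₛ t₀)) hmₛ.le hM₁.le
  have hgreedy := online_greedy_regret (hs.trans hsk)
    (F := fun t => surrogate s (dataUtility A u (y t))) hΔ0
    (fun t => maxSparse_mono s _)
    (fun t => (maxSparse_empty s _).trans (by simp [modularApprox]))
    (fun t a Z => (maxSparse_sum_insert_le s (hbounds t).1 a Z).trans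
      (add_le_add_right (hgain_le t a) _))
    (fun t Y Z => maxSparse_sum_union_le hs (hbounds t).1 Y Z) hXk
  set F : Fin T → Finset V → ℝ := fun t => surrogate s (dataUtility A u (y t)) with hF
  set η := hedgeRate (Fintype.card V) T Δmax with hη
  have hplayed : f₀ + m₁ / Mₛ * trajExp F η
        (fun ω : Fin T → Fin k → V => ∑ t, F t (playedSet (ω t)))
      ≤ trajExp F η (fun ω : Fin T → Fin k → V =>
        ∑ t, objective s (dataUtility A u (y t)) (playedSet (ω t))) := by
    rw [← trajExp_const (k := k) F η f₀, ← trajExp_const_mul, ← trajExp_add]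
    refine trajExp_mono F η fun ω => ?_
    rw [hf₀, Finset.mul_sum, ← Finset.sum_add_distrib]
    refine Finset.sum_le_sum fun t _ => ?_
    have := ((hbounds t).2 (playedSet (ω t))).1
    linarith
  have hopt : ∑ t, objective s (dataUtility A u (y t)) X
      ≤ f₀ + M₁ / mₛ * ∑ t, F t X := by
    rw [hf₀, Finset.mul_sum, ← Finset.sum_add_distrib]
    refine Finset.sum_le_sum fun t _ => ?_
    have := ((hbounds t).2 X).2
    linarith
  have h1 := mul_le_mul_of_nonneg_left hopt hα0
  -- The value of `α` is exactly what turns the comparator's factor `M₁/mₛ` into the algorithm's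
  -- `m₁/Mₛ`.
  have h2 : α * (M₁ / mₛ * ∑ t, F t X)
      = m₁ / Mₛ * ((1 - 1 / Real.exp 1) * ∑ t, F t X) := by
    rw [hα]
    field_simp
  have h3 := mul_le_mul_of_nonneg_left hgreedy (by positivity : 0 ≤ m₁ / Mₛ)
  have h4 : m₁ / Mₛ * (k * (Δmax * Real.sqrt (2 * T * Real.log (Fintype.card V))))
      = k * Δmax * m₁ / Mₛ * Real.sqrt (2 * T * Real.log (Fintype.card V)) := by
    ring
  -- The offset counts `α` times for the comparator and once for the algorithm.
  have h5 : α * f₀ ≤ f₀ := by nlinarith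
  rw [h4, mul_sub] at h3
  rw [mul_add, h2] at h1
  linarith
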